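/- Let $A$ be a commutative ring with $1$ and let $i\ge j\ge 1$ be integers with $\gcd(i,j)=1$. Let $$R(A;i,j,1,1)=A\langle x,y : x^iy+yx^j=1,\ y^2=0\rangle$$ be the quotient of the free associative unital $A$-algebra on $x,y$ by the two-sided ideal generated by $x^iy+yx^j-1$ and $y^2$. Let $A[s,t]$ be the polynomial ring in two commuting variables over $A$, and define $f(n)\in A[s,t]$ for integers $n\ge 0$ by $f(0)=0$, $f(1)=1$ and $f(n)=t\,f(n-1)+s\,f(n-2)$ for $n\ge 2$. Let $I$ be the ideal $$I=\left(f(i+j),\ f(i+j-1)-s^{j-1},\ s^{i-j}-(-1)^{i-j}\right)$$ of $A[s,t]$. Then $$R(A;i,j,1,1)\cong M_2\big(A[s,t]/I\big)$$ as $A$-algebras. In particular, $R(A;i,j,1,1)$ is a $2\times 2$ matrix ring over a commutative ring. -/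

import Mathlib

namespace MatrixRelations

universe u

/-- The defining relations `x^i y^m + y^n x^j = 1` and `y^(m+n) = 0` in the free algebra
`A⟨x, y⟩`, where the generator `x` has index `0` and the generator `y` has index `1`. -/
inductive Rel (A : Type u) [CommRing A] (i j m n : ℕ) :
    FreeAlgebra A (Fin 2) → FreeAlgebra A (Fin 2) → Prop
  | unit : Rel A i j m n
      (FreeAlgebra.ι A 0 ^ i * FreeAlgebra.ι A 1 ^ m
        + FreeAlgebra.ι A 1 ^ n * FreeAlgebra.ι A 0 ^ j) 1
  | nilpotent : Rel A i j m n (FreeAlgebra.ι A 1 ^ (m + n)) 0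

/-- The algebra `R(A; i, j, m, n) = A⟨x, y : x^i y^m + y^n x^j = 1, y^(m+n) = 0⟩`, the quotient
of the free algebra by the two-sided ideal that the relations generate. -/
abbrev R (A : Type u) [CommRing A] (i j m n : ℕ) : Type u :=
  RingQuot (Rel A i j m n)

/-- The polynomial ring `A[s, t]`. -/
abbrev Poly (A : Type u) [CommRing A] : Type u := MvPolynomial (Fin 2) A

/-- The variable `s` of `A[s, t]`. -/
noncomputable def s (A : Type u) [CommRing A] : Poly A := MvPolynomial.X 0

/-- The variable `t` of `A[s, t]`. -/
noncomputable def t (A : Type u) [CommRing A] : Poly A := MvPolynomial.X 1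

/-- The recursion `f(0) = 0`, `f(1) = 1`, `f(n) = t f(n-1) + s f(n-2)` for `n ≥ 2`. -/
noncomputable def f (A : Type u) [CommRing A] : ℕ → Poly A
  | 0 => 0
  | 1 => 1
  | n + 2 => t A * f A (n + 1) + s A * f A n

/-- The ideal `I = (f(i+j), f(i+j-1) - s^(j-1), s^(i-j) - (-1)^(i-j))` of `A[s, t]`. It is used
only for `1 ≤ j ≤ i`, where no subtraction of natural numbers is truncated. -/
noncomputable def I (A : Type u) [CommRing A] (i j : ℕ) : Ideal (Poly A) :=
  Ideal.span {f A (i + j), f A (i + j - 1) - s A ^ (j - 1), s A ^ (i - j) - (-1) ^ (i - j)}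

end MatrixRelations

/-! Put `a = x^i` and `b = x^j`. The relations make `ay`, `ayb`, `y`, `yb` into 2×2 matrix units,
and since `a` and `b` commute, `a - b` and `ab` commute with `y`, hence are central. So `a = (a -
b)·ay + ayb + ab·y` is a matrix over the center. If `i > j`, then `ab = x^(i+j)` is invertible
(`exists_right_inv`), and `gcd(i, j) = 1` gives `x = a^m b^(-n)`; so `x` too is a matrix `X` over
the center (`exists_good`).

By Cayley–Hamilton the powers of `X` are governed by the Lucas sequence in `s = -det X`, `t = tr X`.
The relations turn into the generators of `I`, up to the sign of `t` (`Good.sol`, `sol_iff`), and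
they determine `X` from `s` and `t` (`Good.eq_solMatrix`). Conversely `solMatrix` solves them over
`A[s,t]/I` (`Sol.good`). The resulting map from `R` to the matrix ring has a left inverse, and it is
onto because its image contains the matrix units while `s`, `t` generate the quotient. -/

namespace MatrixRelations

/-! ### Consequences of `ay + yb = 1`, `y² = 0`. -/

section Noncommutative

variable {S : Type*} [Ring S] {a b y : S}

theorem mul_left_mul (h : a * y + y * b = 1) (hy : y * y = 0) : y * a * y = y := by
  have := congrArg (y * ·) h
  simpa [mul_add, ← mul_assoc, hy] using this

theorem mul_right_mul (h : a * y + y * b = 1) (hy : y * y = 0) : y * b * y = y := by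
  have := congrArg (· * y) h
  simpa [add_mul, mul_assoc, hy] using this

theorem mul_comm_mul (h : a * y + y * b = 1) (hy : y * y = 0) : y * b * (a * y) = 0 := by
  have h1 := mul_left_mul h hy
  have h2 : y * b = 1 - a * y := eq_sub_of_add_eq' h
  rw [h2, sub_mul, one_mul, sub_eq_zero, mul_assoc a, ← mul_assoc y, h1]

/-- Inserting `1 = a y + y b` between two factors. -/
theorem insert_one (h : a * y + y * b = 1) (c d : S) :
    c * d = c * a * (y * d) + c * y * (b * d) := by
  calc c * d = c * (a * y + y * b) * d := by rw [h, mul_one]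
    _ = _ := by noncomm_ring

theorem sandwich_sub (h : a * y + y * b = 1) (hy : y * y = 0) : y * ((a - b) * y) = 0 := by
  have h1 := mul_left_mul h hy
  have h2 := mul_right_mul h hy
  rw [sub_mul, mul_sub, ← mul_assoc, ← mul_assoc, h1, h2, sub_self]

/-- Inserting `1 = ay + yb` puts both `ab·y` and `y·ab` into `ySy`. They differ, up to sign, by
`y(ab)(a - b)y`, which one more insertion kills. -/
theorem commute_prod (h : a * y + y * b = 1) (hy : y * y = 0) (hab : a * b = b * a) :
    Commute (a * b) y := by
  have h3 := mul_comm_mul h hy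
  have h0 : y * (a * b) * y = 0 := by rw [hab, ← h3]; noncomm_ring
  have e1 : a * b * y = y * (a * b * b) * y := by
    have h4 : a * y * (a * b * y) = 0 := by
      rw [show a * y * (a * b * y) = a * (y * (a * b) * y) by noncomm_ring, h0, mul_zero]
    calc a * b * y = (a * y + y * b) * (a * b * y) := by rw [h, one_mul]
      _ = y * b * (a * b * y) := by rw [add_mul, h4, zero_add]
      _ = y * (b * a * b) * y := by noncomm_ring
      _ = _ := by rw [← hab]
  have e2 : y * (a * b) = y * (a * b * a) * y := by
    calc y * (a * b) = y * (a * b) * (a * y + y * b) := by rw [h, mul_one]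
      _ = y * (a * b * a) * y + y * (a * b) * y * b := by noncomm_ring
      _ = _ := by rw [h0, zero_mul, add_zero]
  have e3 : y * (a * b) * ((a - b) * y) = 0 := by
    rw [insert_one h, sandwich_sub h hy, h0, mul_zero, zero_mul, add_zero]
  rw [Commute, SemiconjBy, e1, e2, ← sub_eq_zero, ← neg_eq_zero, ← e3]
  noncomm_ring

/-- The commutator reduces to `y(a - b)²y` up to sign; inserting `1` between the factors `a - b`
kills it because `y(a - b)y = 0`. -/
theorem commute_sub (h : a * y + y * b = 1) (hy : y * y = 0) (hab : a * b = b * a) :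
    Commute (a - b) y := by
  have h1 := mul_left_mul h hy
  have h2 := mul_right_mul h hy
  have h3 := mul_comm_mul h hy
  have h0 : y * (a * b) * y = 0 := by rw [hab, ← h3]; noncomm_ring
  have h0' : y * (b * a) * y = 0 := by rw [← hab, h0]
  have e : y * (a - b) * ((a - b) * y) = 0 := by
    rw [insert_one h, sandwich_sub h hy, mul_assoc y (a - b) y, sandwich_sub h hy]
    simp
  have e' : y * a * a * y + y * b * b * y = 0 := by
    have : y * (a - b) * ((a - b) * y)
        = y * a * a * y + y * b * b * y - y * (a * b) * y - y * (b * a) * y := by noncomm_ring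
    rw [e, h0, h0', sub_zero, sub_zero] at this
    exact this.symm
  have e1 : b * y = a * y + y * b * b * y := by
    calc b * y = (a * y + y * b) * (b * y) := by rw [h, one_mul]
      _ = a * (y * b * y) + y * b * b * y := by noncomm_ring
      _ = _ := by rw [h2]
  have e2 : y * a = y * b + y * a * a * y := by
    calc y * a = y * a * (a * y + y * b) := by rw [h, mul_one]
      _ = (y * a * y) * b + y * a * a * y := by noncomm_ring
      _ = _ := by rw [h1]
  rw [Commute, SemiconjBy, sub_mul, mul_sub, e1, e2, eq_neg_of_add_eq_zero_left e']
  abel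

theorem exists_pow_add (α β G H : S) (hαβ : Commute α β) (h : α * G + β * H = 1) (n : ℕ) :
    ∃ K, α ^ n * G ^ n + β * K = 1 := by
  induction n with
  | zero => exact ⟨0, by simp⟩
  | succ n ih =>
    obtain ⟨K, hK⟩ := ih
    refine ⟨K + α ^ n * (H * G ^ n), ?_⟩
    have h1 : β * (α ^ n * (H * G ^ n)) = α ^ n * (β * H) * G ^ n := by
      rw [← mul_assoc, ← (hαβ.pow_left n).eq]; noncomm_ring
    rw [mul_add, h1, pow_succ α, pow_succ' G, ← hK,
      show β * H = 1 - α * G from eq_sub_of_add_eq' h]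
    noncomm_ring

/-- Modulo `β = x^(i+j)`, `x` is nilpotent, so `x^d - 1` with `d = i - j` is a unit, and `α =
x^j(x^d - 1)` divides `x^j` and `x^i`. As `α`, `β` commute with `y`, the relation puts `1` in `αS +
βS`; but a power of `α` is a multiple of `β`. -/
theorem exists_right_inv {x : S} {i j : ℕ} (hj : 1 ≤ j) (hji : j < i)
    (h : x ^ i * y + y * x ^ j = 1) (hy : y * y = 0) : ∃ K, x ^ (i + j) * K = 1 := by
  obtain ⟨k, rfl⟩ := Nat.exists_eq_add_of_lt hji
  set d := k + 1 with hd
  have hi : j + k + 1 = j + d := by omega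
  rw [hi] at h ⊢
  set β := x ^ (j + d + j) with hβ
  set α := x ^ (j + d) - x ^ j with hα
  have hα' : α = x ^ j * (x ^ d - 1) := by rw [hα, pow_add]; noncomm_ring
  have hcx : Commute α x := by
    rw [hα]; exact ((Commute.refl x).pow_left _).sub_left ((Commute.refl x).pow_left _)
  have hcβ : Commute α β := hcx.pow_right _
  have hab : x ^ (j + d) * x ^ j = x ^ j * x ^ (j + d) := by rw [← pow_add, ← pow_add, add_comm]
  have hcy : Commute α y := commute_sub h hy hab
  have hβy : Commute β y := by
    have := commute_prod h hy hab
    rwa [← pow_add] at this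
  set N := j + d + j with hN
  -- A truncated geometric series: the inverse of `x^d - 1` modulo `x^(dN) = β^d`.
  set g := -∑ l ∈ Finset.range N, (x ^ d) ^ l with hg
  have hgeom : α * g + β * (β ^ (d - 1) * x ^ j) = x ^ j := by
    have h1 : (x ^ d - 1) * g = 1 - x ^ (d * N) := by
      rw [hg, mul_neg, mul_geom_sum, pow_mul, neg_sub]
    have h2 : β * (β ^ (d - 1) * x ^ j) = x ^ j * x ^ (d * N) := by
      rw [← mul_assoc, ← pow_succ', hβ, ← pow_mul, ← pow_add, ← pow_add, hd]
      congr 1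
      simp; ring
    rw [hα', mul_assoc, h1, h2]
    noncomm_ring
  have hgeom' : α * (g + 1) + β * (β ^ (d - 1) * x ^ j) = x ^ (j + d) := by
    rw [mul_add, add_right_comm, hgeom, hα]; noncomm_ring
  set w := β ^ (d - 1) * x ^ j
  have hone : α * ((g + 1) * y + y * g) + β * (w * y + y * w) = 1 := by
    have e1 : y * (α * g) = α * (y * g) := by rw [← mul_assoc, ← hcy.eq, mul_assoc]
    have e2 : y * (β * w) = β * (y * w) := by rw [← mul_assoc, ← hβy.eq, mul_assoc]
    calc _ = (α * (g + 1) + β * w) * y + (α * (y * g) + β * (y * w)) := by noncomm_ring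
      _ = (α * (g + 1) + β * w) * y + y * (α * g + β * w) := by rw [mul_add y, e1, e2]
      _ = 1 := by rw [hgeom', hgeom, h]
  obtain ⟨K, hK⟩ := exists_pow_add α β _ _ hcβ hone N
  have hαN : α ^ N = β * (β ^ (j - 1) * (x ^ d - 1) ^ N) := by
    have hc : Commute (x ^ j) (x ^ d - 1) :=
      ((Commute.refl x).pow_pow _ _).sub_right (Commute.one_right _)
    rw [hα', hc.mul_pow, ← mul_assoc, ← pow_succ', Nat.sub_add_cancel hj, hβ, ← pow_mul, ← pow_mul,
      mul_comm]
  refine ⟨β ^ (j - 1) * (x ^ d - 1) ^ N * ((g + 1) * y + y * g) ^ N + K, ?_⟩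
  rw [mul_add, ← mul_assoc, ← hαN, hK]

end Noncommutative

/-! ### Lucas sequences and 2×2 solutions over a commutative ring. -/

section Commutative

variable {Z : Type*} [CommRing Z]

/-- The sequence `f` with `s` and `t` specialised to elements of a commutative ring. -/
def lucas (s t : Z) : ℕ → Z
  | 0 => 0
  | 1 => 1
  | n + 2 => t * lucas s t (n + 1) + s * lucas s t n

theorem lucas_add_two (s t : Z) (n : ℕ) :
    lucas s t (n + 2) = t * lucas s t (n + 1) + s * lucas s t n := rfl

theorem map_lucas {Z' : Type*} [CommRing Z'] (g : Z →+* Z') (s t : Z) (n : ℕ) :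
    g (lucas s t n) = lucas (g s) (g t) n := by
  induction n using Nat.twoStepInduction with
  | zero => simp [lucas]
  | one => simp [lucas]
  | more n h1 h2 => simp [lucas_add_two, h1, h2]

theorem f_eq_lucas (A : Type*) [CommRing A] (n : ℕ) : f A n = lucas (s A) (t A) n := by
  induction n using Nat.twoStepInduction with
  | zero => simp [lucas, f]
  | one => simp [lucas, f]
  | more n h1 h2 => rw [f, h1, h2, lucas_add_two]

theorem lucas_neg (s t : Z) (n : ℕ) : lucas s (-t) (n + 1) = (-1) ^ n * lucas s t (n + 1) := by
  induction n using Nat.twoStepInduction with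
  | zero => simp [lucas]
  | one => simp [lucas]
  | more n h1 h2 =>
    rw [lucas_add_two, h2, lucas_add_two s t (n + 1), h1]
    ring

theorem lucas_add (s t : Z) (m n : ℕ) : lucas s t (m + n + 1) =
    lucas s t (m + 1) * lucas s t (n + 1) + s * lucas s t m * lucas s t n := by
  induction n using Nat.twoStepInduction with
  | zero => simp [lucas]
  | one => rw [lucas_add_two]; simp [lucas]; ring
  | more n h1 h2 =>
    rw [show m + (n + 2) + 1 = (m + n + 1) + 2 by ring, lucas_add_two,
      show m + n + 1 + 1 = m + (n + 1) + 1 by ring, h1, h2, lucas_add_two s t (n + 1),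
      lucas_add_two s t n]
    ring

/-- After a zero at `m + 1`, running the recursion backwards reproduces the sequence up to scaling.
With `m = i+j-1`, `k = j-1` this compares `f(i)` with `f(j)`. -/
theorem lucas_reflect {s t : Z} {m : ℕ} (hm : lucas s t (m + 1) = 0) (k : ℕ) :
    ∀ l, k + l = m → (-s) ^ k * lucas s t l = lucas s t m * lucas s t (k + 1) := by
  induction k using Nat.twoStepInduction with
  | zero => rintro l rfl; simp [lucas]
  | one =>
    rintro l rfl
    rw [show 1 + l + 1 = l + 2 by ring, lucas_add_two] at hm
    rw [add_comm 1 l, lucas_add_two]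
    simp only [lucas]
    linear_combination -hm
  | more k h1 h2 =>
    intro l hl
    have e1 := h1 (l + 2) (by omega)
    have e2 := h2 (l + 1) (by omega)
    rw [lucas_add_two] at e1
    rw [lucas_add_two s t (k + 1)]
    linear_combination t * e2 + s * e1

theorem isCoprime_lucas_succ {s : Z} (hs : IsUnit s) (t : Z) (n : ℕ) :
    IsCoprime (lucas s t n) (lucas s t (n + 1)) := by
  induction n with
  | zero => simpa [lucas] using isCoprime_one_right
  | succ n ih =>
    rw [lucas_add_two, mul_comm t, IsCoprime.mul_add_left_right_iff]
    exact (isCoprime_mul_unit_left_right hs _ _).2 ih.symm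

/-- Euclid's algorithm on the indices, by `lucas_add`; a unit `s` makes consecutive terms coprime.
-/
theorem isCoprime_lucas {s : Z} (hs : IsUnit s) (t : Z) (m n : ℕ) (hmn : Nat.Coprime m n) :
    IsCoprime (lucas s t m) (lucas s t n) := by
  induction hN : m + n using Nat.strong_induction_on generalizing m n with
  | _ N ih =>
    wlog hle : m ≤ n generalizing m n
    · exact (this n m hmn.symm (by omega) (by omega)).symm
    obtain ⟨d, rfl⟩ := Nat.exists_eq_add_of_le hle
    rcases m with _ | m
    · have hd : d = 1 := by simpa using hmn
      subst hd
      simpa [lucas] using isCoprime_one_right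
    rcases d with _ | d
    · have : m = 0 := by simpa using hmn
      subst this
      simpa [lucas] using isCoprime_one_left
    have h1 : IsCoprime (lucas s t (m + 1)) (lucas s t (d + 1)) :=
      ih (m + 1 + (d + 1)) (by omega) _ _ (by simpa using hmn) rfl
    rw [show m + 1 + (d + 1) = (m + 1) + d + 1 by ring, lucas_add, mul_comm s, mul_assoc]
    exact (IsCoprime.add_mul_left_right ((isCoprime_lucas_succ hs t (m + 1)).mul_right h1) _)

/-- The relations on `s = -det` and `t = trace` that a generic solution satisfies. -/
structure Sol (i j : ℕ) (s t : Z) : Prop where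
  zero : lucas s t (i + j) = 0
  pred : lucas s t (i + j - 1) = (-s) ^ (j - 1)
  pow : s ^ (i - j) = (-1) ^ (i - j)

/-- The conditions on the entries of `X ^ i` and `X ^ j` which express the defining relations
when `y` is the matrix unit `E₂₁`. -/
structure Good (i j : ℕ) (X : Matrix (Fin 2) (Fin 2) Z) : Prop where
  i01 : (X ^ i) 0 1 = 1
  j01 : (X ^ j) 0 1 = 1
  i11 : (X ^ i) 1 1 = 0
  j00 : (X ^ j) 0 0 = 0

/-- For `i = j` the relation on `s^(i-j)` is empty, but coprimality leaves only `i = j = 1`. -/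
theorem Sol.isUnit_or {i j : ℕ} {s t : Z} (h : Sol i j s t) (hji : j ≤ i)
    (hij : Nat.gcd i j = 1) : IsUnit s ∨ (i = 1 ∧ j = 1) := by
  rcases hji.lt_or_eq with hlt | rfl
  · left
    have h1 : IsUnit (s ^ (i - j)) := by
      rw [h.pow]; exact (isUnit_one.neg).pow _
    exact (isUnit_pow_iff (by omega)).1 h1
  · right
    simpa using hij

theorem Sol.lucas_eq {i j : ℕ} {s t : Z} (h : Sol i j s t) (hj : 1 ≤ j) (hji : j ≤ i)
    (hij : Nat.gcd i j = 1) : lucas s t i = lucas s t j := by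
  rcases h.isUnit_or hji hij with hs | ⟨rfl, rfl⟩
  · have h1 := lucas_reflect (m := i + j - 1) (by rw [Nat.sub_add_cancel (by omega), h.zero])
      (j - 1) i (by omega)
    rw [h.pred, Nat.sub_add_cancel hj] at h1
    exact (hs.neg.pow _).mul_left_cancel h1
  · rfl

/-- `f(i)` and `f(j)` are both coprime and equal. -/
theorem Sol.isUnit_lucas {i j : ℕ} {s t : Z} (h : Sol i j s t) (hj : 1 ≤ j) (hji : j ≤ i)
    (hij : Nat.gcd i j = 1) : IsUnit (lucas s t i) := by
  rcases h.isUnit_or hji hij with hs | ⟨rfl, rfl⟩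
  · have h1 := isCoprime_lucas hs t i j hij
    rw [← h.lucas_eq hj hji hij] at h1
    exact isCoprime_self.1 h1
  · simp [lucas]

theorem pow_succ_eq_lucas {s t : Z} {X : Matrix (Fin 2) (Fin 2) Z} (ht : X.trace = t)
    (hs : X.det = -s) (n : ℕ) :
    X ^ (n + 1) = lucas s t (n + 1) • X + (s * lucas s t n) • (1 : Matrix (Fin 2) (Fin 2) Z) := by
  have h2 : X * X = t • X + s • (1 : Matrix (Fin 2) (Fin 2) Z) := by
    have hs' : s = -X.det := by rw [hs, neg_neg]
    subst hs' ht
    ext k l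
    fin_cases k <;> fin_cases l <;>
      simp [Matrix.mul_apply, Fin.sum_univ_two, Matrix.det_fin_two, Matrix.trace_fin_two] <;> ring
  induction n with
  | zero => simp [lucas]
  | succ n ih =>
    rw [pow_succ, ih, add_mul, smul_mul_assoc, h2, smul_mul_assoc, one_mul, lucas_add_two]
    module

/-- The matrix with trace `t` and determinant `-s` that solves the relations, where `q` is the
inverse of `lucas s t i`. -/
def solMatrix (i j : ℕ) (s t q : Z) : Matrix (Fin 2) (Fin 2) Z :=
  !![-s * q * lucas s t (j - 1), q;
    (s * q * lucas s t (j - 1) * (s * q * lucas s t (i - 1)) + s) * lucas s t i,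
    -s * q * lucas s t (i - 1)]

theorem map_solMatrix {Z' : Type*} [CommRing Z'] (g : Z →+* Z') (i j : ℕ) (s t q : Z) :
    (solMatrix i j s t q).map g = solMatrix i j (g s) (g t) (g q) := by
  ext k l
  fin_cases k <;> fin_cases l <;> simp [solMatrix, map_lucas]

theorem Sol.trace_solMatrix {i j : ℕ} {s t q : Z} (h : Sol i j s t) (hj : 1 ≤ j) (hji : j ≤ i)
    (hij : Nat.gcd i j = 1) (hq : lucas s t i * q = 1) : (solMatrix i j s t q).trace = t := by
  have he := h.lucas_eq hj hji hij
  obtain ⟨i, rfl⟩ := Nat.exists_eq_add_of_le' (hj.trans hji)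
  obtain ⟨j, rfl⟩ := Nat.exists_eq_add_of_le' hj
  have h0 := h.zero
  rw [show i + 1 + (j + 1) = (i + 1) + j + 1 by ring, lucas_add, ← he, lucas_add_two] at h0
  simp only [solMatrix, Matrix.trace_fin_two, Nat.add_sub_cancel]
  simp
  linear_combination (-q * q) * h0 + ((t * lucas s t (i + 1) + s * lucas s t i + s * lucas s t j) * q
    + t) * hq

theorem det_solMatrix {i j : ℕ} {s t q : Z} (hq : lucas s t i * q = 1) :
    (solMatrix i j s t q).det = -s := by
  simp only [solMatrix, Matrix.det_fin_two_of]
  linear_combination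
    (-(s * q * lucas s t (j - 1) * (s * q * lucas s t (i - 1)) + s)) * hq

theorem Sol.good {i j : ℕ} {s t q : Z} (h : Sol i j s t) (hj : 1 ≤ j) (hji : j ≤ i)
    (hij : Nat.gcd i j = 1) (hq : lucas s t i * q = 1) : Good i j (solMatrix i j s t q) := by
  have he := h.lucas_eq hj hji hij
  have key := pow_succ_eq_lucas (h.trace_solMatrix hj hji hij hq) (det_solMatrix (j := j) hq)
  have hi := key (i - 1)
  have hj' := key (j - 1)
  rw [Nat.sub_add_cancel (hj.trans hji)] at hi
  rw [Nat.sub_add_cancel hj] at hj'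
  constructor
  · rw [hi]; simpa [solMatrix] using hq
  · rw [hj', ← he]; simpa [solMatrix] using hq
  · rw [hi]; simp [solMatrix]; linear_combination (-s * lucas s t (i - 1)) * hq
  · rw [hj', ← he]; simp [solMatrix]; linear_combination (-s * lucas s t (j - 1)) * hq

section GoodMatrix

variable {i j : ℕ} {X : Matrix (Fin 2) (Fin 2) Z}

theorem Good.relation (h : Good i j X) :
    X ^ i * Matrix.single 1 0 1 + Matrix.single 1 0 1 * X ^ j = 1 := by
  ext k l
  fin_cases k <;> fin_cases l <;>
    simp [Matrix.mul_apply, Matrix.single_apply, h.i01, h.j01, h.i11, h.j00]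

theorem Good.entries (h : Good i j X) (hj : 1 ≤ j) (hji : j ≤ i) :
    (lucas (-X.det) X.trace i * X 0 1 = 1 ∧ lucas (-X.det) X.trace j * X 0 1 = 1) ∧
    lucas (-X.det) X.trace i * X 1 1 + -X.det * lucas (-X.det) X.trace (i - 1) = 0 ∧
    lucas (-X.det) X.trace j * X 0 0 + -X.det * lucas (-X.det) X.trace (j - 1) = 0 := by
  have key := pow_succ_eq_lucas (X := X) (s := -X.det) rfl (by rw [neg_neg])
  have hi := key (i - 1)
  have hj' := key (j - 1)
  rw [Nat.sub_add_cancel (hj.trans hji)] at hi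
  rw [Nat.sub_add_cancel hj] at hj'
  have h1 := h.i01
  have h2 := h.j01
  have h3 := h.i11
  have h4 := h.j00
  rw [hi] at h1 h3
  rw [hj'] at h2 h4
  simp only [Matrix.add_apply, Matrix.smul_apply, Matrix.one_apply, smul_eq_mul] at h1 h2 h3 h4
  simp at h1 h2 h3 h4
  refine ⟨⟨h1, h2⟩, ?_, ?_⟩
  · linear_combination h3
  · linear_combination h4

theorem Good.lucas_eq (h : Good i j X) (hj : 1 ≤ j) (hji : j ≤ i) :
    lucas (-X.det) X.trace i = lucas (-X.det) X.trace j := by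
  obtain ⟨⟨h1, h2⟩, -, -⟩ := h.entries hj hji
  linear_combination lucas (-X.det) X.trace j * h1 - lucas (-X.det) X.trace i * h2

/-- Cayley–Hamilton makes the conditions linear in `X 0 0`, `X 0 1`, `X 1 1`; the determinant then
yields `X 1 0`. -/
theorem Good.eq_solMatrix (h : Good i j X) (hj : 1 ≤ j) (hji : j ≤ i) {q : Z}
    (hq : lucas (-X.det) X.trace i * q = 1) : X = solMatrix i j (-X.det) X.trace q := by
  obtain ⟨⟨h1, h2⟩, h3, h4⟩ := h.entries hj hji
  rw [← h.lucas_eq hj hji] at h4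
  have hq' : q = X 0 1 := by linear_combination X 0 1 * hq - q * h1
  subst hq'
  have hd := X.det_fin_two
  generalize X.det = D at *
  generalize X.trace = T at *
  have e11 : X 1 1 = D * X 0 1 * lucas (-D) T (i - 1) := by
    linear_combination X 0 1 * h3 - X 1 1 * h1
  have e00 : X 0 0 = D * X 0 1 * lucas (-D) T (j - 1) := by
    linear_combination X 0 1 * h4 - X 0 0 * h1
  ext k l
  fin_cases k <;> fin_cases l
  · simpa [solMatrix] using e00
  · simp [solMatrix]
  · simp [solMatrix]
    rw [← e00, ← e11]
    linear_combination -X 1 0 * h1 + lucas (-D) T i * hd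
  · simpa [solMatrix] using e11

end GoodMatrix

end Commutative

/-! ### Matrix units from the relations. -/

section MatrixUnits

variable {Z S : Type*} [CommRing Z] [Ring S] [Algebra Z S] {a b y : S}

/-- The homomorphism from `2 × 2` matrices that sends the matrix units to `a y`, `a y b`, `y`
and `y b`. -/
def matrixHom (Z : Type*) [CommRing Z] [Algebra Z S] (h : a * y + y * b = 1) (hy : y * y = 0) :
    Matrix (Fin 2) (Fin 2) Z →ₐ[Z] S :=
  AlgHom.ofLinearMap
    { toFun := fun M => M 0 0 • (a * y) + M 0 1 • (a * y * b) + M 1 0 • y + M 1 1 • (y * b)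
      map_add' := fun M N => by simp only [Matrix.add_apply]; module
      map_smul' := fun c M => by
        simp only [Matrix.smul_apply, smul_eq_mul, RingHom.id_apply]; module }
    (by simp [h])
    (fun M N => by
      have h1 : y * (a * y) = y := by rw [← mul_assoc, mul_left_mul h hy]
      have h2 : y * (b * y) = y := by rw [← mul_assoc, mul_right_mul h hy]
      have h3 : y * (b * (a * y)) = 0 := by rw [← mul_assoc, mul_comm_mul h hy]
      have h1' : y * (a * (y * b)) = y * b := by rw [← mul_assoc a, ← mul_assoc, h1]
      have h2' : y * (b * (y * b)) = y * b := by rw [← mul_assoc b, ← mul_assoc, h2]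
      have h3' : y * (b * (a * (y * b))) = 0 := by
        rw [← mul_assoc a, ← mul_assoc b, ← mul_assoc, h3, zero_mul]
      have h4' : y * (y * b) = 0 := by rw [← mul_assoc, hy, zero_mul]
      simp only [LinearMap.coe_mk, AddHom.coe_mk, Matrix.mul_apply, Fin.sum_univ_two, add_mul,
        mul_add, smul_mul_smul_comm, mul_assoc, h1, h2, h3, h1', h2', h3', h4', hy, mul_zero,
        smul_zero]
      module)

theorem matrixHom_apply (h : a * y + y * b = 1) (hy : y * y = 0) (M : Matrix (Fin 2) (Fin 2) Z) :
    matrixHom Z h hy M =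
      M 0 0 • (a * y) + M 0 1 • (a * y * b) + M 1 0 • y + M 1 1 • (y * b) := rfl

/-- Extracts an entry as a scalar by ring operations; used for both injectivity and surjectivity. -/
theorem sum_single_mul_mul_single (M : Matrix (Fin 2) (Fin 2) Z) (k l : Fin 2) :
    ∑ m, Matrix.single m k 1 * M * Matrix.single l m 1
      = M k l • (1 : Matrix (Fin 2) (Fin 2) Z) := by
  rw [Fin.sum_univ_two]
  ext k' l'
  fin_cases k <;> fin_cases l <;> fin_cases k' <;> fin_cases l' <;>
    simp

theorem matrixHom_injective (h : a * y + y * b = 1) (hy : y * y = 0)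
    (hZ : Function.Injective (algebraMap Z S)) : Function.Injective (matrixHom Z h hy) := by
  rw [injective_iff_map_eq_zero]
  intro M hM
  ext k l
  have h1 := congrArg (matrixHom Z h hy) (sum_single_mul_mul_single M k l)
  rw [map_sum, map_smul, map_one, ← Algebra.algebraMap_eq_smul_one] at h1
  simp only [map_mul, hM, mul_zero, zero_mul, Finset.sum_const_zero] at h1
  exact hZ (by rw [← h1, Matrix.zero_apply, map_zero])

end MatrixUnits

/-! ### Relations on determinant and trace. -/

theorem Good.sol {Z : Type*} [CommRing Z] {i j : ℕ} {X : Matrix (Fin 2) (Fin 2) Z}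
    (h : Good i j X) (hj : 1 ≤ j) (hji : j ≤ i) : Sol i j (-X.det) X.trace := by
  obtain ⟨⟨h1, h2⟩, h3, h4⟩ := h.entries hj hji
  have he := h.lucas_eq hj hji
  have hzero : lucas (-X.det) X.trace (i + j) = 0 := by
    obtain ⟨i, rfl⟩ := Nat.exists_eq_add_of_le' (hj.trans hji)
    obtain ⟨j, rfl⟩ := Nat.exists_eq_add_of_le' hj
    simp only [Nat.add_sub_cancel] at h3 h4
    rw [show i + 1 + (j + 1) = (i + 1) + j + 1 by ring, lucas_add, lucas_add_two]
    rw [← he] at h4 ⊢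
    have ht : X.trace = X 0 0 + X 1 1 := X.trace_fin_two
    linear_combination lucas (-X.det) X.trace (i + 1) *
      (lucas (-X.det) X.trace (i + 1) * ht + h3 + h4)
  refine ⟨hzero, ?_, ?_⟩
  · have hr := lucas_reflect (m := i + j - 1) (by rw [Nat.sub_add_cancel (by omega), hzero])
      (j - 1) i (by omega)
    rw [Nat.sub_add_cancel hj, ← he] at hr
    linear_combination -X 0 1 * hr + ((-(-X.det)) ^ (j - 1)
      - lucas (-X.det) X.trace (i + j - 1)) * h1
  · rcases hji.lt_or_eq with hlt | rfl
    · have hdet : X.det ^ i = X.det ^ j := by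
        have key := pow_succ_eq_lucas (X := X) (s := -X.det) rfl (by rw [neg_neg])
        have hi := key (i - 1)
        have hj' := key (j - 1)
        rw [Nat.sub_add_cancel (hj.trans hji)] at hi
        rw [Nat.sub_add_cancel hj] at hj'
        -- Each of `det (X^i)`, `det (X^j)` is minus its `(1,0)` entry, and these entries agree
        -- since `f(i) = f(j)`.
        have hi10 : (X ^ i) 1 0 = (X ^ j) 1 0 := by rw [hi, hj', ← he]; simp
        rw [← Matrix.det_pow, ← Matrix.det_pow, Matrix.det_fin_two, Matrix.det_fin_two, h.i01,
          h.j01, h.i11, h.j00, hi10]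
        ring
      -- Applied in the matrix ring, this makes `det X` a unit, so `det X ^ j` can be cancelled.
      obtain ⟨K, hK⟩ := exists_right_inv hj hlt h.relation (by simp)
      have hu : IsUnit X.det := by
        have h5 := congrArg Matrix.det hK
        rw [Matrix.det_mul, Matrix.det_pow, Matrix.det_one] at h5
        exact (isUnit_pow_iff (by omega)).1 (IsUnit.of_mul_eq_one _ h5)
      have h6 : X.det ^ (i - j) = 1 := by
        apply (hu.pow j).mul_left_cancel
        rw [← pow_add, Nat.add_sub_cancel' hji, hdet, mul_one]
      rw [neg_pow, h6, mul_one]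
    · simp

/-- Reconciles `(-s)^(j-1)` with the `s^(j-1)` of `I`. They differ only for even `j`; then `i` is
odd, and `t ↦ -t` changes the sign of `f(i+j-1)`. -/
theorem sol_iff {Z : Type*} [CommRing Z] {i j : ℕ} (hj : 1 ≤ j) (hji : j ≤ i)
    (hij : Nat.gcd i j = 1) (s t : Z) : Sol i j s ((-1) ^ (j - 1) * t) ↔
      lucas s t (i + j) = 0 ∧ lucas s t (i + j - 1) = s ^ (j - 1) ∧
        s ^ (i - j) = (-1) ^ (i - j) := by
  have hS : ∀ t' : Z, Sol i j s t' ↔ lucas s t' (i + j) = 0 ∧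
      lucas s t' (i + j - 1) = (-s) ^ (j - 1) ∧ s ^ (i - j) = (-1) ^ (i - j) := fun t' =>
    ⟨fun h => ⟨h.zero, h.pred, h.pow⟩, fun h => ⟨h.1, h.2.1, h.2.2⟩⟩
  rw [hS]
  rcases Nat.even_or_odd (j - 1) with he | ho
  · rw [he.neg_one_pow, he.neg_pow, one_mul]
  · have hjE : Even j := by
      have := ho.add_one
      rwa [Nat.sub_add_cancel hj] at this
    have hiO : Odd i := by
      rw [← Nat.not_even_iff_odd]
      intro hiE
      have := Nat.dvd_gcd hiE.two_dvd hjE.two_dvd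
      rw [hij] at this
      omega
    obtain ⟨n, hn⟩ : ∃ n, i + j = n + 2 := ⟨i + j - 2, by omega⟩
    have hnO : Odd n := by
      have h1 : Odd (i + j) := hiO.add_even hjE
      rw [hn] at h1
      simpa [Nat.odd_add] using h1
    rw [ho.neg_one_pow, ho.neg_pow, neg_one_mul, hn, lucas_neg, show n + 2 - 1 = n + 1 from rfl,
      lucas_neg, hnO.neg_one_pow, hnO.add_one.neg_one_pow]
    simp

/-! ### The generator `x` as a matrix over the center. -/

section Center

variable {A S : Type*} [CommRing A] [Ring S] [Algebra A S] {x y : S}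

instance centerAlgebra : Algebra (Subalgebra.center A S) S where
  algebraMap := (Subalgebra.center A S).val.toRingHom
  commutes' r v := (Subalgebra.mem_center_iff.1 r.2 v).symm
  smul_def' _ _ := rfl

instance center_isScalarTower : IsScalarTower A (Subalgebra.center A S) S where
  smul_assoc a z v := by
    rw [Subalgebra.smul_def, Subalgebra.smul_def, Subalgebra.coe_smul, smul_assoc]

theorem mem_center_of_commute (hgen : Algebra.adjoin A {x, y} = ⊤) {z : S} (hx : Commute z x)
    (hy : Commute z y) : z ∈ Subalgebra.center A S := by
  rw [Subalgebra.mem_center_iff]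
  intro w
  have h1 : Algebra.adjoin A {x, y} ≤ Subalgebra.centralizer A {z} := by
    rw [Algebra.adjoin_le_iff]
    rintro v (rfl | rfl)
    · simpa [Set.mem_centralizer_iff] using hx.eq
    · simpa [Set.mem_centralizer_iff] using hy.eq
  have h2 : w ∈ Subalgebra.centralizer A {z} := h1 (hgen ▸ Algebra.mem_top)
  exact (Subalgebra.mem_centralizer_iff A |>.1 h2 z rfl).symm

/-- Products of central combinations of `1` and `a` are again such combinations when
`a * a` is one. -/
theorem exists_mul_eq {a : S} {α β : Subalgebra.center A S}
    (haa : a * a = α • a + β • (1 : S)) {v w : S}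
    (hv : ∃ u q : Subalgebra.center A S, v = u • (1 : S) + q • a)
    (hw : ∃ u q : Subalgebra.center A S, w = u • (1 : S) + q • a) :
    ∃ u q : Subalgebra.center A S, v * w = u • (1 : S) + q • a := by
  obtain ⟨u, q, rfl⟩ := hv
  obtain ⟨u', q', rfl⟩ := hw
  refine ⟨u * u' + q * q' * β, u * q' + q * u' + q * q' * α, ?_⟩
  simp only [add_mul, mul_add, smul_mul_smul_comm, one_mul, mul_one, haa]
  module

theorem exists_pow_eq {a : S} {α β : Subalgebra.center A S}
    (haa : a * a = α • a + β • (1 : S)) {v : S}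
    (hv : ∃ u q : Subalgebra.center A S, v = u • (1 : S) + q • a) (n : ℕ) :
    ∃ u q : Subalgebra.center A S, v ^ n = u • (1 : S) + q • a := by
  induction n with
  | zero => exact ⟨1, 0, by simp⟩
  | succ n ih => rw [pow_succ]; exact exists_mul_eq haa ih hv

theorem exists_good (hgen : Algebra.adjoin A {x, y} = ⊤) {i j : ℕ} (hj : 1 ≤ j) (hji : j ≤ i)
    (hij : Nat.gcd i j = 1) (h : x ^ i * y + y * x ^ j = 1) (hy : y * y = 0) :
    ∃ X : Matrix (Fin 2) (Fin 2) (Subalgebra.center A S),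
      matrixHom (Subalgebra.center A S) h hy X = x ∧ Good i j X := by
  have hab : x ^ i * x ^ j = x ^ j * x ^ i := by rw [← pow_add, ← pow_add, add_comm]
  have hxi : Commute (x ^ i) x := (Commute.refl x).pow_left _
  have hxj : Commute (x ^ j) x := (Commute.refl x).pow_left _
  obtain ⟨α, hα⟩ : ∃ α : Subalgebra.center A S, (α : S) = x ^ i - x ^ j :=
    ⟨⟨_, mem_center_of_commute hgen (hxi.sub_left hxj) (commute_sub h hy hab)⟩, rfl⟩
  obtain ⟨β, hβ⟩ : ∃ β : Subalgebra.center A S, (β : S) = x ^ i * x ^ j :=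
    ⟨⟨_, mem_center_of_commute hgen (hxi.mul_left hxj) (commute_prod h hy hab)⟩, rfl⟩
  have haa : x ^ i * x ^ i = α • x ^ i + β • (1 : S) := by
    rw [Subalgebra.smul_def, Subalgebra.smul_def, hα, hβ, smul_eq_mul, smul_eq_mul, hab]
    noncomm_ring
  have hxi' : ∃ u q : Subalgebra.center A S, x ^ i = u • (1 : S) + q • x ^ i := ⟨0, 1, by simp⟩
  have hx : ∃ u q : Subalgebra.center A S, x = u • (1 : S) + q • x ^ i := by
    rcases hji.lt_or_eq with hlt | rfl
    · obtain ⟨K, hK⟩ := exists_right_inv hj hlt h hy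
      rw [pow_add, ← hβ] at hK
      have hcx : Commute (β : S) x := by rw [hβ]; exact hxi.mul_left hxj
      have hβK : (β : S) * K = K * β := (Subalgebra.mem_center_iff.1 β.2 K).symm
      have hcen : K ∈ Subalgebra.center A S := by
        rw [Subalgebra.mem_center_iff]
        intro w
        have hw := Subalgebra.mem_center_iff.1 β.2 w
        calc w * K = K * β * (w * K) := by rw [← hβK, hK, one_mul]
          _ = K * (w * β) * K := by rw [hw]; noncomm_ring
          _ = K * w := by rw [mul_assoc, mul_assoc w, hK, mul_one]
      -- Bézout: `x = x^(im) x^(-jn)`, where `κ x^i` inverts `x^j`.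
      obtain ⟨m, n, hmn⟩ : ∃ m n, i * m = j * n + 1 := by
        rcases hj.lt_or_eq with hj1 | rfl
        · obtain ⟨m, -, hm⟩ := Nat.exists_mul_mod_eq_one_of_coprime hij hj1
          exact ⟨m, i * m / j, by rw [← hm, Nat.div_add_mod]⟩
        · exact ⟨1, i - 1, by omega⟩
      obtain ⟨κ, rfl⟩ : ∃ κ : Subalgebra.center A S, (κ : S) = K := ⟨⟨K, hcen⟩, rfl⟩
      have hinv : x ^ j * (κ • x ^ i) = 1 := by
        rw [mul_smul_comm, ← hab, ← hβ, Subalgebra.smul_def, smul_eq_mul, ← hβK, hK]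
      have hcomm : Commute (x ^ j) (κ • x ^ i) := ((Commute.refl x).pow_pow j i).smul_right κ
      have hx' : x = (x ^ i) ^ m * (κ • x ^ i) ^ n := by
        rw [← pow_mul, hmn, pow_succ', pow_mul, mul_assoc, ← hcomm.mul_pow, hinv, one_pow,
          mul_one]
      obtain ⟨u, q, huq⟩ := exists_mul_eq haa (exists_pow_eq haa hxi' m)
        (exists_pow_eq haa (v := κ • x ^ i) ⟨0, κ, by simp⟩ n)
      exact ⟨u, q, hx'.trans huq⟩
    · obtain rfl : j = 1 := by simpa using hij
      exact ⟨0, 1, by simp⟩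
  obtain ⟨u, q, hx⟩ := hx
  have hPi : matrixHom (Subalgebra.center A S) h hy !![α, 1; β, 0] = x ^ i := by
    rw [matrixHom_apply]
    simp [Subalgebra.smul_def, hα, hβ]
    calc _ = x ^ i * (x ^ i * y + y * x ^ j) + (x ^ i * x ^ j - x ^ j * x ^ i) * y := by
          noncomm_ring
      _ = x ^ i := by rw [h, hab]; simp
  have hPj : matrixHom (Subalgebra.center A S) h hy !![0, 1; β, -α] = x ^ j := by
    rw [matrixHom_apply]
    simp [Subalgebra.smul_def, hα, hβ]
    calc _ = x ^ j * (x ^ i * y + y * x ^ j) + (x ^ i * x ^ j - x ^ j * x ^ i) * y := by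
          noncomm_ring
      _ = x ^ j := by rw [h, hab]; simp
  have hX : matrixHom (Subalgebra.center A S) h hy
      (u • (1 : Matrix (Fin 2) (Fin 2) (Subalgebra.center A S)) + q • !![α, 1; β, 0]) = x := by
    rw [map_add, map_smul, map_smul, map_one, hPi, ← hx]
  have hinj := matrixHom_injective (Z := Subalgebra.center A S) h hy Subtype.val_injective
  refine ⟨_, hX, ?_⟩
  have hi := hinj ((map_pow _ _ i).trans ((congrArg (· ^ i) hX).trans hPi.symm))
  have hj' := hinj ((map_pow _ _ j).trans ((congrArg (· ^ j) hX).trans hPj.symm))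
  constructor
  · rw [hi]; simp
  · rw [hj']; simp
  · rw [hi]; simp
  · rw [hj']; simp

end Center

/-! ### Universal property of `R`. -/

section Presentation

variable (A : Type*) [CommRing A] (i j : ℕ)

/-- The image of the generator of index `k` in `R(A; i, j, 1, 1)`. -/
noncomputable def gen (k : Fin 2) : R A i j 1 1 :=
  RingQuot.mkAlgHom A (Rel A i j 1 1) (FreeAlgebra.ι A k)

theorem gen_relation : gen A i j 0 ^ i * gen A i j 1 + gen A i j 1 * gen A i j 0 ^ j = 1 := by
  have h := RingQuot.mkAlgHom_rel A (Rel.unit (A := A) (i := i) (j := j) (m := 1) (n := 1))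
  simpa [gen] using h

theorem gen_sq : gen A i j 1 * gen A i j 1 = 0 := by
  have h := RingQuot.mkAlgHom_rel A (Rel.nilpotent (A := A) (i := i) (j := j) (m := 1) (n := 1))
  simpa [gen, pow_two] using h

theorem adjoin_gen : Algebra.adjoin A {gen A i j 0, gen A i j 1} = ⊤ := by
  have h := congrArg (Subalgebra.map (RingQuot.mkAlgHom A (Rel A i j 1 1)))
    (FreeAlgebra.adjoin_range_ι A (Fin 2))
  rw [AlgHom.map_adjoin, Algebra.map_top,
    (AlgHom.range_eq_top _).2 (RingQuot.mkAlgHom_surjective A _), ← Set.range_comp] at h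
  rw [← h]
  congr 1
  ext z
  simp [Fin.exists_fin_two, gen, eq_comm]

variable {A i j}

/-- The universal property of `R(A; i, j, 1, 1)`. -/
noncomputable def liftR {T : Type*} [Ring T] [Algebra A T] (x y : T)
    (h : x ^ i * y + y * x ^ j = 1) (hy : y * y = 0) : R A i j 1 1 →ₐ[A] T :=
  RingQuot.liftAlgHom A ⟨FreeAlgebra.lift A ![x, y], by
    rintro _ _ (_ | _)
    · simpa using h
    · simpa [pow_two] using hy⟩

theorem liftR_gen_zero {T : Type*} [Ring T] [Algebra A T] (x y : T)
    (h : x ^ i * y + y * x ^ j = 1) (hy : y * y = 0) :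
    liftR (A := A) x y h hy (gen A i j 0) = x := by
  simp [liftR, gen]

theorem liftR_gen_one {T : Type*} [Ring T] [Algebra A T] (x y : T)
    (h : x ^ i * y + y * x ^ j = 1) (hy : y * y = 0) :
    liftR (A := A) x y h hy (gen A i j 1) = y := by
  simp [liftR, gen]

theorem algHom_ext_gen {T : Type*} [Ring T] [Algebra A T] {g g' : R A i j 1 1 →ₐ[A] T}
    (h0 : g (gen A i j 0) = g' (gen A i j 0)) (h1 : g (gen A i j 1) = g' (gen A i j 1)) :
    g = g' :=
  AlgHom.ext_of_adjoin_eq_top (adjoin_gen A i j) (by rintro _ (rfl | rfl) <;> assumption)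

end Presentation

/-! ### Universal property and generators of `A[s,t]/I`. -/

section Quotient

variable {A : Type*} [CommRing A] {i j : ℕ}

theorem neg_one_pow_mul_self_mul {Z : Type*} [CommRing Z] (n : ℕ) (z : Z) :
    (-1) ^ n * ((-1) ^ n * z) = z := by
  rw [← mul_assoc, ← mul_pow]; simp

theorem sol_mk (hj : 1 ≤ j) (hji : j ≤ i) (hij : Nat.gcd i j = 1) :
    Sol i j (Ideal.Quotient.mk (I A i j) (s A))
      ((-1) ^ (j - 1) * Ideal.Quotient.mk (I A i j) (t A)) := by
  rw [sol_iff hj hji hij, ← map_lucas, ← map_lucas, ← f_eq_lucas, ← f_eq_lucas]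
  have hmem : ∀ p ∈ ({f A (i + j), f A (i + j - 1) - s A ^ (j - 1),
      s A ^ (i - j) - (-1) ^ (i - j)} : Set (Poly A)), Ideal.Quotient.mk (I A i j) p = 0 :=
    fun p hp => Ideal.Quotient.eq_zero_iff_mem.2 (Ideal.subset_span hp)
  refine ⟨hmem _ (by simp), ?_, ?_⟩
  · have := hmem (f A (i + j - 1) - s A ^ (j - 1)) (by simp)
    rwa [map_sub, map_pow, sub_eq_zero] at this
  · have := hmem (s A ^ (i - j) - (-1) ^ (i - j)) (by simp)
    rwa [map_sub, map_pow, map_pow, map_neg, map_one, sub_eq_zero] at this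

theorem exists_quotient_hom (hj : 1 ≤ j) (hji : j ≤ i) (hij : Nat.gcd i j = 1) {Z : Type*}
    [CommRing Z] [Algebra A Z] {s' t' : Z} (h : Sol i j s' t') :
    ∃ c : (Poly A ⧸ I A i j) →ₐ[A] Z, c (Ideal.Quotient.mk (I A i j) (s A)) = s' ∧
      c ((-1) ^ (j - 1) * Ideal.Quotient.mk (I A i j) (t A)) = t' := by
  have hsign := neg_one_pow_mul_self_mul (j - 1) t'
  have h' := h
  rw [← hsign, sol_iff hj hji hij] at h'
  set e : Poly A →ₐ[A] Z := MvPolynomial.aeval ![s', (-1) ^ (j - 1) * t'] with he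
  have hs : e (s A) = s' := by simp [he, s]
  have ht : e (t A) = (-1) ^ (j - 1) * t' := by simp [he, t]
  have hf : ∀ n, e (f A n) = lucas s' ((-1) ^ (j - 1) * t') n := fun n => by
    rw [f_eq_lucas, ← hs, ← ht]
    exact map_lucas (e : Poly A →+* Z) _ _ _
  have hI : ∀ p ∈ I A i j, e p = 0 := by
    have : I A i j ≤ RingHom.ker e := by
      rw [I, Ideal.span_le]
      rintro _ (rfl | rfl | rfl)
      · simpa [hf] using h'.1
      · simpa [hf, hs, sub_eq_zero] using h'.2.1
      · simpa [hs, sub_eq_zero] using h'.2.2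
    exact fun p hp => this hp
  refine ⟨Ideal.Quotient.liftₐ (I A i j) e hI, ?_, ?_⟩
  · exact hs
  · rw [map_mul, map_pow, map_neg, map_one]
    refine Eq.trans ?_ hsign
    congr 1

theorem quotient_subalgebra_eq_top (U : Subalgebra A (Poly A ⧸ I A i j))
    (hs : Ideal.Quotient.mk (I A i j) (s A) ∈ U)
    (ht : (-1) ^ (j - 1) * Ideal.Quotient.mk (I A i j) (t A) ∈ U) : U = ⊤ := by
  have ht' : Ideal.Quotient.mk (I A i j) (t A) ∈ U := by
    rw [← neg_one_pow_mul_self_mul (j - 1) (Ideal.Quotient.mk (I A i j) (t A))]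
    exact U.mul_mem (U.pow_mem (U.neg_mem U.one_mem) (j - 1)) ht
  rw [eq_top_iff]
  rintro z -
  obtain ⟨p, rfl⟩ := Ideal.Quotient.mk_surjective z
  induction p using MvPolynomial.induction_on with
  | C a => exact U.algebraMap_mem a
  | add p q hp hq => rw [map_add]; exact U.add_mem hp hq
  | mul_X p k hp =>
    rw [map_mul]
    refine U.mul_mem hp ?_
    fin_cases k
    · exact hs
    · exact ht'

end Quotient

/-! ### Generating the full matrix ring. -/

section Surjectivity

variable {A Z : Type*} [CommRing A] [CommRing Z] [Algebra A Z]

/-- A subalgebra of `M₂(Z)` that contains the matrix units is `M₂` of the algebra of its scalars. -/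
theorem subalgebra_matrix_eq_top (T : Subalgebra A (Matrix (Fin 2) (Fin 2) Z))
    (hT : ∀ k l, Matrix.single k l 1 ∈ T) {X : Matrix (Fin 2) (Fin 2) Z} (hX : X ∈ T)
    (hgen : ∀ U : Subalgebra A Z, -X.det ∈ U → X.trace ∈ U → U = ⊤) : T = ⊤ := by
  let U : Subalgebra A Z := T.comap (IsScalarTower.toAlgHom A Z (Matrix (Fin 2) (Fin 2) Z))
  have hU : ∀ z, z ∈ U ↔ z • (1 : Matrix (Fin 2) (Fin 2) Z) ∈ T := fun z => by
    rw [← Algebra.algebraMap_eq_smul_one]; rfl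
  have hent : ∀ k l, X k l ∈ U := fun k l => by
    rw [hU, ← sum_single_mul_mul_single]
    exact T.sum_mem fun m _ => T.mul_mem (T.mul_mem (hT _ _) hX) (hT _ _)
  have hUtop : U = ⊤ := by
    apply hgen
    · rw [Matrix.det_fin_two]
      exact U.neg_mem (U.sub_mem (U.mul_mem (hent _ _) (hent _ _))
        (U.mul_mem (hent _ _) (hent _ _)))
    · rw [Matrix.trace_fin_two]
      exact U.add_mem (hent _ _) (hent _ _)
  rw [eq_top_iff]
  rintro M -
  rw [Matrix.matrix_eq_sum_single M]
  refine T.sum_mem fun k _ => T.sum_mem fun l _ => ?_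
  have h1 : Matrix.single k l (M k l)
      = (M k l • (1 : Matrix (Fin 2) (Fin 2) Z)) * Matrix.single k l 1 := by
    rw [smul_mul_assoc, one_mul, Matrix.smul_single, smul_eq_mul, mul_one]
  rw [h1]
  exact T.mul_mem ((hU _).1 (hUtop ▸ Algebra.mem_top)) (hT _ _)

theorem Good.single_mem {i j : ℕ} {X : Matrix (Fin 2) (Fin 2) Z} (h : Good i j X)
    (T : Subalgebra A (Matrix (Fin 2) (Fin 2) Z)) (hX : X ∈ T)
    (hY : Matrix.single 1 0 1 ∈ T) (k l : Fin 2) : Matrix.single k l 1 ∈ T := by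
  have h00 : (Matrix.single 0 0 1 : Matrix (Fin 2) (Fin 2) Z) = X ^ i * Matrix.single 1 0 1 := by
    ext k l
    fin_cases k <;> fin_cases l <;> simp [h.i01, h.i11]
  have h11 : (Matrix.single 1 1 1 : Matrix (Fin 2) (Fin 2) Z) = Matrix.single 1 0 1 * X ^ j := by
    ext k l
    fin_cases k <;> fin_cases l <;> simp [h.j01, h.j00]
  have h01 : (Matrix.single 0 1 1 : Matrix (Fin 2) (Fin 2) Z)
      = X ^ i * Matrix.single 1 1 1 := by
    ext k l
    fin_cases k <;> fin_cases l <;> simp [h.i01, h.i11]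
  have m00 : (Matrix.single 0 0 1 : Matrix (Fin 2) (Fin 2) Z) ∈ T :=
    h00 ▸ T.mul_mem (T.pow_mem hX _) hY
  have m11 : (Matrix.single 1 1 1 : Matrix (Fin 2) (Fin 2) Z) ∈ T :=
    h11 ▸ T.mul_mem hY (T.pow_mem hX _)
  have m01 : (Matrix.single 0 1 1 : Matrix (Fin 2) (Fin 2) Z) ∈ T :=
    h01 ▸ T.mul_mem (T.pow_mem hX _) m11
  fin_cases k <;> fin_cases l <;> assumption

end Surjectivity

end MatrixRelations

/-! ### The isomorphism. -/

open MatrixRelations in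
theorem theorem2p10 {A : Type*} [CommRing A] (i j : ℕ) (hj : 1 ≤ j) (hji : j ≤ i)
    (hij : Nat.gcd i j = 1) :
    Nonempty (MatrixRelations.R A i j 1 1 ≃ₐ[A]
      Matrix (Fin 2) (Fin 2) (MatrixRelations.Poly A ⧸ MatrixRelations.I A i j)) := by
  have hsol := sol_mk (A := A) hj hji hij
  obtain ⟨q, hq⟩ := (hsol.isUnit_lucas hj hji hij).exists_right_inv
  have hgood := hsol.good hj hji hij hq
  have htr := hsol.trace_solMatrix hj hji hij hq
  have hdet := det_solMatrix (j := j) hq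
  set N := solMatrix i j _ _ q with hN
  let φ := liftR (A := A) N (Matrix.single 1 0 1) hgood.relation (by simp)
  have hφ0 : φ (gen A i j 0) = N := liftR_gen_zero _ _ _ _
  have hφ1 : φ (gen A i j 1) = Matrix.single 1 0 1 := liftR_gen_one _ _ _ _
  obtain ⟨X, hX, hXgood⟩ :=
    exists_good (adjoin_gen A i j) hj hji hij (gen_relation A i j) (gen_sq A i j)
  obtain ⟨c, hcs, hct⟩ := exists_quotient_hom (A := A) hj hji hij (hXgood.sol hj hji)
  -- Both sides are the `solMatrix` of the same `s`, `t`, as inverses of `f(i)` are unique.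
  have hcN : N.map c = X := by
    have h1 := map_lucas c.toRingHom (Ideal.Quotient.mk (I A i j) (s A))
      ((-1) ^ (j - 1) * Ideal.Quotient.mk (I A i j) (t A)) i
    have h2 := congrArg c.toRingHom hq
    rw [map_mul, h1, map_one] at h2
    have h3 := map_solMatrix c.toRingHom i j
      (Ideal.Quotient.mk (I A i j) (s A))
      ((-1) ^ (j - 1) * Ideal.Quotient.mk (I A i j) (t A)) q
    simp only [AlgHom.toRingHom_eq_coe, RingHom.coe_coe, hcs, hct] at h2 h3
    exact h3.trans (hXgood.eq_solMatrix hj hji h2).symm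
  let ψ := ((matrixHom (Subalgebra.center A (R A i j 1 1)) (gen_relation A i j)
    (gen_sq A i j)).restrictScalars A).comp c.mapMatrix
  have hψφ : ψ.comp φ = AlgHom.id A _ := by
    apply algHom_ext_gen
    · rw [AlgHom.comp_apply, hφ0]
      exact (congrArg _ hcN).trans hX
    · rw [AlgHom.comp_apply, hφ1]
      simp [ψ, matrixHom_apply]
  refine ⟨AlgEquiv.ofBijective φ ⟨?_, ?_⟩⟩
  · exact Function.LeftInverse.injective (g := ψ) fun z => DFunLike.congr_fun hψφ z
  · have hN : N ∈ φ.range := ⟨_, hφ0⟩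
    rw [← AlgHom.range_eq_top]
    refine subalgebra_matrix_eq_top _ (hgood.single_mem _ hN ⟨_, hφ1⟩) hN ?_
    rw [htr, hdet, neg_neg]
    exact quotient_subalgebra_eq_top
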